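/- Let $n\in\mathbb N$, $p>n$, $\alpha\in(0,n)$, $\sigma=\frac{p\alpha}{p+\alpha-n}$ and $\gamma>1+\sigma$. Let $\phi\colon[0,\infty)\to[0,\infty)$ be a gauge function (i.e. non-decreasing, continuous and vanishing only at $0$) such that $$\phi(r)\sim r^\sigma\big(\log\tfrac1r\big)^\gamma\quad\text{as } r\to0^+,$$ where $\sim$ means that each side is bounded by a positive constant times the other for all sufficiently small $r>0$. Then there exist a continuous map $u\colon\mathbb R^n\to\mathbb R^n$ belonging to $V^{1,p}(\mathbb R^n,\mathbb R^n)$ and a compact set $E\subset\mathbb R^n$ such that $$0<\mathscr H^\alpha(E)<\infty\qquad\text{and}\qquad \mathscr H^\phi(u(E))=\infty.$$ Here $V^{1,p}(\mathbb R^n,\mathbb R^n)$ is the space of locally integrable, weakly differentiable maps $u\colon\mathbb R^n\to\mathbb R^n$ with $|\nabla u|\in L^p(\mathbb R^n)$, $\mathscr H^\alpha$ is the $\alpha$-dimensional Hausdorff measure, and $$\mathscr H^\phi(F)=\lim_{\delta\to0^+}\inf\Big\{\sum_{i=1}^\infty\phi(\operatorname{diam}F_i)\;:\;F\subset\bigcup_{i=1}^\infty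 F_i,\ \operatorname{diam}F_i\le\delta\Big\}$$ is the Hausdorff measure built on the gauge $\phi$. -/

import Mathlib

open scoped NNReal ENNReal Topology ContDiff
open MeasureTheory Filter Asymptotics

/-- A gauge function on `[0, ∞)`: nondecreasing, continuous, and vanishing exactly at `0`. -/
structure IsGauge (φ : ℝ≥0 → ℝ≥0) : Prop where
  monotone : Monotone φ
  continuous : Continuous φ
  eq_zero_iff : ∀ r, φ r = 0 ↔ r = 0

/-- The Hausdorff measure `ℋ^φ` built on the gauge `φ`: the limit, as `δ → 0⁺`, of the infimum of
`∑ φ (diam Eᵢ)` over all countable covers by sets of diameter at most `δ`. (The value that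
`ENNReal.toNNReal` gives to an infinite diameter is irrelevant, since only covers by sets of small
diameter matter in the limit.) -/
noncomputable def gaugeHausdorffMeasure {n : ℕ} (φ : ℝ≥0 → ℝ≥0) :
    Measure (EuclideanSpace ℝ (Fin n)) :=
  Measure.mkMetric fun d : ℝ≥0∞ => (φ d.toNNReal : ℝ≥0∞)

/-- The locally integrable field `G` is a weak gradient of `u : ℝⁿ → ℝᵐ`: for every scalar test
function `ψ` and every direction `v`, `∫ (∂ᵥψ) u = - ∫ ψ (G v)`. -/
def IsWeakGradient {n m : ℕ} (u : EuclideanSpace ℝ (Fin n) → EuclideanSpace ℝ (Fin m))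
    (G : EuclideanSpace ℝ (Fin n) →
      (EuclideanSpace ℝ (Fin n) →L[ℝ] EuclideanSpace ℝ (Fin m))) : Prop :=
  LocallyIntegrable G volume ∧
    ∀ ψ : EuclideanSpace ℝ (Fin n) → ℝ, ContDiff ℝ ∞ ψ → HasCompactSupport ψ →
      ∀ v : EuclideanSpace ℝ (Fin n),
        ∫ x, (fderiv ℝ ψ x v) • u x = - ∫ x, ψ x • G x v

/-- The homogeneous Sobolev space `V^{1,p}(ℝⁿ, ℝᵐ)`: locally integrable, weakly differentiable maps
whose weak gradient belongs to `Lᵖ(ℝⁿ)`. -/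
def MemHomogeneousSobolev {n m : ℕ} (p : ℝ≥0∞)
    (u : EuclideanSpace ℝ (Fin n) → EuclideanSpace ℝ (Fin m)) : Prop :=
  LocallyIntegrable u volume ∧
    ∃ G : EuclideanSpace ℝ (Fin n) →
        (EuclideanSpace ℝ (Fin n) →L[ℝ] EuclideanSpace ℝ (Fin m)),
      IsWeakGradient u G ∧ MemLp G p volume

/-! Put `l = 2^(-n/α)` and `μ = 2^(-n/σ)`, both below `1/2`. `E` is the self-similar Cantor set with
`2^n` corner pieces of ratio `l`, coded by digit sequences `ξ`; since `l^α = 2^(-n)`, its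
`α`-dimensional measure is positive and finite. Set `u = ∑ a_k U_k` with `a_k = μ^k (k+1)^(-b)` and
`1 < b < γ/σ`, where `U_k` reads off the `k`-th digit on `E`. Then `u` carries `E` onto the Cantor
set with scales `a_k`.

Sobolev bound: `U_k` comes from one fixed map by `k` transplantations to the corners
(`exists_digit_maps`). Each one multiplies the bound on the gradient's `L^p` norm by `l⁻¹
(2l)^(n/p)`, which for this `σ` equals `μ⁻¹` (`image_ratio_mul_gradient_ratio`). The norms of the
gradients of `a_k U_k` are thus at most a constant times `(k+1)^(-b)`, a summable sequence.

Infinite measure: the uniform measure on digits gives mass at most `2^(-n(k+1))` to sets of diameter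
below a constant times `a_k`, while at that scale `φ` is at least of order `2^(-nk) (k+1)^(γ - bσ)`.
The quotient tends to infinity, and `one_le_mkMetric_range_digitSum` concludes. -/

/-! ### Sobolev regularity of series -/

/-- The sum of a uniformly summable series of compactly supported `C¹` maps whose gradients are
summable in `Lᵖ` belongs to the homogeneous Sobolev space. -/
theorem memHomogeneousSobolev_tsum {n m : ℕ} {p q : ℝ≥0∞} [hpq : p.HolderConjugate q]
    (u : ℕ → EuclideanSpace ℝ (Fin n) → EuclideanSpace ℝ (Fin m)) (B : ℕ → ℝ)
    (hu : ∀ k, ContDiff ℝ 1 (u k)) (hc : ∀ k, HasCompactSupport (u k))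
    (hB : Summable B) (huB : ∀ k x, ‖u k x‖ ≤ B k)
    (hG : Summable fun k => (eLpNorm (fderiv ℝ (u k)) p volume).toReal) :
    MemHomogeneousSobolev p fun x => ∑' k, u k x := by
  have : Fact (1 ≤ p) := ⟨ENNReal.HolderConjugate.one_le p q⟩
  have : q.HolderConjugate p := hpq.symm
  have : Fact (1 ≤ q) := ⟨ENNReal.HolderConjugate.one_le q p⟩
  have hcont : Continuous fun x => ∑' k, u k x :=
    continuous_tsum (fun k => (hu k).continuous) hB huB
  have hfc : ∀ k, Continuous (fderiv ℝ (u k)) := fun k => (hu k).continuous_fderiv one_ne_zero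
  have hfs : ∀ k, HasCompactSupport (fderiv ℝ (u k)) := fun k => (hc k).fderiv ℝ
  have hmem : ∀ k, MemLp (fderiv ℝ (u k)) p volume := fun k =>
    (hfc k).memLp_of_hasCompactSupport (hfs k)
  let g : ℕ → Lp (EuclideanSpace ℝ (Fin n) →L[ℝ] EuclideanSpace ℝ (Fin m)) p volume :=
    fun k => (hmem k).toLp
  have hg : Summable g := by
    refine Summable.of_norm ?_
    simpa only [g, Lp.norm_toLp] using hG
  refine ⟨hcont.locallyIntegrable, ⇑(∑' k, g k), ⟨(Lp.memLp _).locallyIntegrable Fact.out, ?_⟩,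
    Lp.memLp _⟩
  intro ψ hψ hψc v
  have hψm : MemLp ψ q volume := hψ.continuous.memLp_of_hasCompactSupport hψc
  let P : ℝ →L[ℝ] (EuclideanSpace ℝ (Fin n) →L[ℝ] EuclideanSpace ℝ (Fin m)) →L[ℝ]
      EuclideanSpace ℝ (Fin m) :=
    (ContinuousLinearMap.lsmul ℝ ℝ).bilinearComp (ContinuousLinearMap.id ℝ ℝ)
      (ContinuousLinearMap.apply ℝ (EuclideanSpace ℝ (Fin m)) v)
  -- Testing against `ψ` is a continuous functional on `L^p`, so it commutes with the
  -- `L^p`-convergent sum of gradients.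
  let Φ := P.lpPairing volume q p (hψm.toLp)
  have hΦ : ∀ h, Φ h = ∫ x, ψ x • h x v := fun h => by
    rw [ContinuousLinearMap.lpPairing_eq_integral]
    refine integral_congr_ae ?_
    filter_upwards [hψm.coeFn_toLp] with x hx
    simp [P, hx]
  have hdc : Continuous fun x => fderiv ℝ ψ x v :=
    (hψ.continuous_fderiv (by simp)).clm_apply continuous_const
  have hds : HasCompactSupport fun x => fderiv ℝ ψ x v := hψc.fderiv_apply ℝ v
  have hdi : Integrable (fun x => fderiv ℝ ψ x v) volume := hdc.integrable_of_hasCompactSupport hds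
  have hparts : ∀ k, Φ (g k) = - ∫ x, fderiv ℝ ψ x v • u k x := fun k => by
    rw [hΦ, ← integral_smul_fderiv_eq_neg_fderiv_smul_of_integrable]
    · refine integral_congr_ae ?_
      filter_upwards [(hmem k).coeFn_toLp] with x hx
      simp [g, hx]
    · exact (hdc.smul (hu k).continuous).integrable_of_hasCompactSupport hds.smul_right
    · exact (hψ.continuous.smul ((hfc k).clm_apply continuous_const)).integrable_of_hasCompactSupport
        hψc.smul_right
    · exact (hψ.continuous.smul (hu k).continuous).integrable_of_hasCompactSupport hψc.smul_right
    · exact fun x _ => (hψ.differentiable (by simp)).differentiableAt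
    · exact fun x _ => ((hu k).differentiable one_ne_zero).differentiableAt
  have hsum : HasSum (fun k => ∫ x, fderiv ℝ ψ x v • u k x)
      (∫ x, ∑' k, fderiv ℝ ψ x v • u k x) := by
    refine hasSum_integral_of_summable_integral_norm (fun k =>
      (hdc.smul (hu k).continuous).integrable_of_hasCompactSupport hds.smul_right) ?_
    refine Summable.of_nonneg_of_le (fun k => integral_nonneg fun x => norm_nonneg _)
      (fun k => ?_) (hB.mul_left (∫ x, ‖fderiv ℝ ψ x v‖))
    rw [← integral_mul_const]
    refine integral_mono_of_nonneg (.of_forall fun x => norm_nonneg _) (hdi.norm.mul_const _)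
      (.of_forall fun x => ?_)
    simp only [norm_smul]
    gcongr
    exact huB k x
  have h1 := (hg.hasSum.mapL Φ)
  simp only [hparts] at h1
  rw [← hΦ, h1.unique hsum.neg, neg_neg]
  refine integral_congr_ae (.of_forall fun x => ?_)
  exact ((Summable.of_norm_bounded hB (huB · x)).tsum_const_smul _).symm

/-! ### Cantor sets coded by digit sequences -/

/-- The vertex of the cube `[-1, 1]ⁿ` with the given pattern of signs. -/
noncomputable def signVector {n : ℕ} (w : Fin n → Bool) : EuclideanSpace ℝ (Fin n) :=
  WithLp.toLp 2 fun i => if w i then 1 else -1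

theorem signVector_apply {n : ℕ} (w : Fin n → Bool) (i : Fin n) :
    signVector w i = if w i then 1 else -1 := rfl

theorem norm_signVector {n : ℕ} (w : Fin n → Bool) : ‖signVector w‖ = √n := by
  rw [EuclideanSpace.norm_eq]
  congr 1
  have : ∀ i, ‖signVector w i‖ ^ 2 = 1 := fun i => by
    rw [signVector_apply]; split_ifs <;> simp
  simp only [this]; simp

/-- The point with digits `ξ` in the Cantor set whose scales are given by the sequence `a`. -/
noncomputable def digitSum {n : ℕ} (a : ℕ → ℝ) (ξ : ℕ → Fin n → Bool) :
    EuclideanSpace ℝ (Fin n) :=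
  ∑' k, a k • signVector (ξ k)

section digitSum

variable {n : ℕ} {a : ℕ → ℝ}

theorem norm_smul_signVector_le (w : Fin n → Bool) (r : ℝ) : ‖r • signVector w‖ ≤ |r| * √n := by
  rw [norm_smul, norm_signVector, Real.norm_eq_abs]

theorem summable_digitSum (ha : Summable a) (ξ : ℕ → Fin n → Bool) :
    Summable fun k => a k • signVector (ξ k) :=
  Summable.of_norm_bounded (ha.abs.mul_right _) fun k => norm_smul_signVector_le (ξ k) (a k)

theorem continuous_digitSum (ha : Summable a) :
    Continuous (digitSum a : (ℕ → Fin n → Bool) → EuclideanSpace ℝ (Fin n)) := by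
  refine continuous_tsum (fun k => ?_) (ha.abs.mul_right (√n))
    fun k ξ => norm_smul_signVector_le (ξ k) (a k)
  have : Continuous (signVector : (Fin n → Bool) → EuclideanSpace ℝ (Fin n)) :=
    continuous_of_discreteTopology
  exact (this.comp (continuous_apply k)).const_smul (a k)

theorem digitSum_apply (ha : Summable a) (ξ : ℕ → Fin n → Bool) (i : Fin n) :
    digitSum a ξ i = ∑' k, a k * signVector (ξ k) i := by
  have := (EuclideanSpace.proj (𝕜 := ℝ) i).map_tsum (summable_digitSum ha ξ)
  simpa [digitSum] using this

theorem le_mul_pow_of_ratio {μ : ℝ} (hμ : 0 ≤ μ) (h : ∀ k, a (k + 1) ≤ μ * a k) (k j : ℕ) :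
    a (k + j) ≤ a k * μ ^ j := by
  induction j with
  | zero => simp
  | succ j ih =>
    calc a (k + j + 1) ≤ μ * a (k + j) := h _
      _ ≤ μ * (a k * μ ^ j) := by gcongr
      _ = a k * μ ^ (j + 1) := by ring

theorem summable_of_ratio {μ : ℝ} (hpos : ∀ k, 0 < a k) (hμ : 0 ≤ μ) (hμ' : μ < 1)
    (h : ∀ k, a (k + 1) ≤ μ * a k) : Summable a := by
  refine Summable.of_nonneg_of_le (fun k => (hpos k).le) (fun k => ?_)
    ((summable_geometric_of_lt_one hμ hμ').mul_left (a 0))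
  simpa using le_mul_pow_of_ratio hμ h 0 k

/-- The gap between the two halves of a Cantor interval, relative to the scale. -/
noncomputable def gapRatio (μ : ℝ) : ℝ := 2 * (1 - μ / (1 - μ))

theorem gapRatio_pos {μ : ℝ} (hμ : μ < 1 / 2) : 0 < gapRatio μ := by
  have : μ / (1 - μ) < 1 := by rw [div_lt_one (by linarith)]; linarith
  unfold gapRatio; linarith

/-- In a coordinate where the digits `k` differ, that term contributes `2 * a k`; the later terms
contribute at most `2 * a k * μ / (1 - μ)`, which is smaller because `μ < 1/2`. -/
theorem gapRatio_mul_le_dist {μ : ℝ} (hpos : ∀ k, 0 < a k) (hμ : 0 ≤ μ) (hμ' : μ < 1 / 2)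
    (h : ∀ k, a (k + 1) ≤ μ * a k) {ξ ξ' : ℕ → Fin n → Bool} {k : ℕ}
    (heq : ∀ j < k, ξ j = ξ' j) (hne : ξ k ≠ ξ' k) :
    gapRatio μ * a k ≤ dist (digitSum a ξ) (digitSum a ξ') := by
  have ha : Summable a := summable_of_ratio hpos hμ (by linarith) h
  obtain ⟨i, hi⟩ := Function.ne_iff.1 hne
  have hs : ∀ w : Fin n → Bool, |signVector w i| ≤ 1 := fun w => by
    rw [signVector_apply]; split_ifs <;> simp
  have hsum : ∀ τ : ℕ → Fin n → Bool, Summable fun j => a j * signVector (τ j) i := fun τ =>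
    Summable.of_norm_bounded ha.abs fun j => by
      rw [norm_mul]
      exact mul_le_of_le_one_right (norm_nonneg _) (hs _)
  set d : ℕ → ℝ := fun j => a j * (signVector (ξ j) i - signVector (ξ' j) i) with hd
  have hdsum : Summable d := by
    simpa only [hd, mul_sub] using (hsum ξ).sub (hsum ξ')
  have hcoord : (digitSum a ξ - digitSum a ξ') i = ∑' j, d j := by
    rw [PiLp.sub_apply, digitSum_apply ha, digitSum_apply ha, ← (hsum ξ).tsum_sub (hsum ξ')]
    simp only [hd, mul_sub]
  have hhead : ∑ j ∈ Finset.range (k + 1), d j = d k := by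
    rw [Finset.sum_range_succ, Finset.sum_eq_zero, zero_add]
    intro j hj
    simp [hd, heq j (Finset.mem_range.1 hj)]
  have hdk : |d k| = 2 * a k := by
    rw [hd, abs_mul, abs_of_pos (hpos k), signVector_apply, signVector_apply, mul_comm]
    congr 1
    cases h1 : ξ k i <;> cases h2 : ξ' k i <;> simp_all <;> norm_num
  have hdj : ∀ j, |d (j + (k + 1))| ≤ 2 * a k * μ * μ ^ j := fun j => by
    rw [hd, abs_mul, abs_of_pos (hpos _)]
    have h1 := le_mul_pow_of_ratio hμ h k (j + 1)
    rw [show k + (j + 1) = j + (k + 1) by ring] at h1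
    have h2 : |signVector (ξ (j + (k + 1))) i - signVector (ξ' (j + (k + 1))) i| ≤ 2 :=
      (abs_sub _ _).trans (by linarith [hs (ξ (j + (k + 1))), hs (ξ' (j + (k + 1)))])
    calc _ ≤ a k * μ ^ (j + 1) * 2 := by
          gcongr
          exact mul_nonneg (hpos k).le (pow_nonneg hμ _)
      _ = _ := by ring
  have htail : |∑' j, d (j + (k + 1))| ≤ 2 * a k * μ * (1 - μ)⁻¹ := by
    rw [← Real.norm_eq_abs]
    exact tsum_of_norm_bounded ((hasSum_geometric_of_lt_one hμ (by linarith)).mul_left _) hdj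
  rw [dist_eq_norm]
  refine le_trans ?_ (PiLp.norm_apply_le _ i)
  rw [hcoord, ← hdsum.sum_add_tsum_nat_add (k + 1), hhead, Real.norm_eq_abs]
  have h3 := abs_sub_abs_le_abs_sub (d k) (-∑' j, d (j + (k + 1)))
  rw [abs_neg, sub_neg_eq_add, hdk] at h3
  refine le_trans ?_ h3
  have : gapRatio μ * a k = 2 * a k - 2 * a k * μ * (1 - μ)⁻¹ := by
    rw [gapRatio, div_eq_mul_inv]; ring
  linarith

end digitSum

/-! ### Mass distribution principle -/

/-- The uniform probability measure on digit sequences. -/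
noncomputable def uniformDigits (n : ℕ) : Measure (ℕ → Fin n → Bool) :=
  Measure.infinitePi fun _ => ProbabilityTheory.uniformOn Set.univ

instance (n : ℕ) : IsProbabilityMeasure (uniformDigits n) := by
  unfold uniformDigits; infer_instance

theorem uniformDigits_cylinder {n : ℕ} (ξ : ℕ → Fin n → Bool) (k : ℕ) :
    uniformDigits n {τ | ∀ j < k, τ j = ξ j} = ((2 : ℝ≥0∞) ^ (n * k))⁻¹ := by
  have : {τ | ∀ j < k, τ j = ξ j} = Set.pi (Finset.range k) fun j => {ξ j} := by
    ext τ; simp [Set.mem_pi]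
  rw [this, uniformDigits, Measure.infinitePi_pi _ (by simp)]
  simp [ProbabilityTheory.uniformOn_univ, ENNReal.inv_pow, pow_mul]

section massDistribution

variable {n : ℕ} {a : ℕ → ℝ} {μ : ℝ}

/-- Points whose digits first differ at some `j ≤ k` are at least `gapRatio μ * a k` apart, so a set
of smaller diameter meets only one cylinder of length `k + 1`. -/
theorem uniformDigits_preimage_le (hpos : ∀ k, 0 < a k) (hμ : 0 ≤ μ) (hμ' : μ < 1 / 2)
    (h : ∀ k, a (k + 1) ≤ μ * a k) (s : Set (EuclideanSpace ℝ (Fin n))) (k : ℕ)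
    (hs : Metric.ediam s < ENNReal.ofReal (gapRatio μ * a k)) :
    uniformDigits n (digitSum a ⁻¹' s) ≤ ((2 : ℝ≥0∞) ^ (n * (k + 1)))⁻¹ := by
  have hanti : Antitone a := antitone_nat_of_succ_le fun k =>
    (h k).trans (mul_le_of_le_one_left (hpos k).le (by linarith))
  obtain hE | ⟨ξ, hξ⟩ := (digitSum a ⁻¹' s).eq_empty_or_nonempty
  · simp [hE]
  rw [← uniformDigits_cylinder ξ]
  refine measure_mono fun τ hτ => ?_
  by_contra hcon
  have hex : ∃ j, j < k + 1 ∧ τ j ≠ ξ j := by simpa using hcon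
  classical
  obtain ⟨hj, hne⟩ := Nat.find_spec hex
  have heq : ∀ i < Nat.find hex, τ i = ξ i := fun i hi => by
    by_contra hc
    exact Nat.find_min hex hi ⟨hi.trans hj, hc⟩
  have h1 := gapRatio_mul_le_dist hpos hμ hμ' h heq hne
  have h2 : gapRatio μ * a k ≤ dist (digitSum a τ) (digitSum a ξ) :=
    le_trans (mul_le_mul_of_nonneg_left (hanti (Nat.lt_succ_iff.1 hj)) (gapRatio_pos hμ').le) h1
  have hst : edist (digitSum a τ) (digitSum a ξ) ≤ Metric.ediam s :=
    Metric.edist_le_ediam_of_mem hτ hξ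
  refine absurd hst (not_le.2 (hs.trans_le ?_))
  rw [edist_dist]
  exact ENNReal.ofReal_le_ofReal h2

/-- Mass distribution principle for the Cantor sets `Set.range (digitSum a)`. -/
theorem one_le_mkMetric_range_digitSum (hpos : ∀ k, 0 < a k) (hμ : 0 ≤ μ) (hμ' : μ < 1 / 2)
    (h : ∀ k, a (k + 1) ≤ μ * a k) (hn : n ≠ 0) (m : ℝ≥0∞ → ℝ≥0∞) (K : ℕ)
    (hm : ∀ k ≥ K, ∀ d < ⊤, ENNReal.ofReal (gapRatio μ * a (k + 1)) ≤ d →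
      ((2 : ℝ≥0∞) ^ (n * (k + 1)))⁻¹ ≤ m d) :
    1 ≤ Measure.mkMetric m (Set.range (digitSum a : _ → EuclideanSpace ℝ (Fin n))) := by
  have ha : Summable a := summable_of_ratio hpos hμ (by linarith) h
  have hmeas : Measurable (digitSum a : (ℕ → Fin n → Bool) → EuclideanSpace ℝ (Fin n)) :=
    (continuous_digitSum ha).measurable
  have hc := gapRatio_pos hμ'
  suffices hle : (uniformDigits n).map (digitSum a) ≤ Measure.mkMetric m by
    refine le_trans ?_ (hle _)
    rw [Measure.map_apply hmeas (isCompact_range (continuous_digitSum ha)).measurableSet]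
    simp
  have hbound : ∀ (s : Set (EuclideanSpace ℝ (Fin n))) (k : ℕ),
      Metric.ediam s < ENNReal.ofReal (gapRatio μ * a k) →
      (uniformDigits n).map (digitSum a) s ≤ ((2 : ℝ≥0∞) ^ (n * (k + 1)))⁻¹ := fun s k hs => by
    -- The closure is measurable and has the same diameter.
    refine (measure_mono subset_closure).trans ?_
    rw [Measure.map_apply hmeas isClosed_closure.measurableSet]
    exact uniformDigits_preimage_le hpos hμ hμ' h _ k (by rwa [Metric.ediam_closure])
  refine Measure.le_mkMetric m _ (ENNReal.ofReal (gapRatio μ * a K) / 2)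
    (ENNReal.half_pos (by simpa using mul_pos hc (hpos K))) fun s hs => ?_
  have hsK : Metric.ediam s < ENNReal.ofReal (gapRatio μ * a K) :=
    hs.trans_lt (ENNReal.half_lt_self (by simpa using mul_pos hc (hpos K)) ENNReal.ofReal_ne_top)
  -- For the least such `k`, the diameter lies between the scales `k + 1` and `k`: the upper scale
  -- bounds the mass, the lower one bounds `m`.
  by_cases hex : ∃ k, K ≤ k ∧ ENNReal.ofReal (gapRatio μ * a (k + 1)) ≤ Metric.ediam s
  · classical
    obtain ⟨hK, hk⟩ := Nat.find_spec hex
    refine le_trans (hbound s _ ?_) (hm _ hK _ (hsK.trans_le le_top) hk)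
    obtain heq | hlt := hK.eq_or_lt
    · rwa [← heq]
    · have h1 := Nat.find_min hex (m := Nat.find hex - 1) (by omega)
      rw [not_and, not_le, show Nat.find hex - 1 + 1 = Nat.find hex by omega] at h1
      exact h1 (by omega)
  · push Not at hex
    -- The diameter is below every scale, so the mass is zero.
    refine le_trans (le_of_eq ?_) zero_le
    have hlim : Tendsto (fun k : ℕ => ((2 : ℝ≥0∞) ^ (n * (k + 1 + 1)))⁻¹) atTop (𝓝 0) := by
      have h1 : Tendsto (fun k : ℕ => ((2 : ℝ≥0∞)⁻¹ ^ k)) atTop (𝓝 0) :=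
        ENNReal.tendsto_pow_atTop_nhds_zero_of_lt_one (by simp)
      have h2 : Tendsto (fun k : ℕ => n * (k + 1 + 1)) atTop atTop :=
        tendsto_atTop_mono (fun k => by
          change k ≤ n * (k + 1 + 1)
          nlinarith [Nat.pos_of_ne_zero hn]) tendsto_id
      simpa [Function.comp_def, ENNReal.inv_pow] using h1.comp h2
    refine le_antisymm (ge_of_tendsto hlim ?_) zero_le
    filter_upwards [eventually_ge_atTop K] with k hk
    exact hbound s (k + 1) (hex k hk)

end massDistribution

/-! ### Transplantation to the corners of the cube -/

section branchSum

variable {n : ℕ} {W : Type*} [NormedAddCommGroup W] {l R : ℝ}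
  {F : EuclideanSpace ℝ (Fin n) → W}

/-- The inverse of the similarity of ratio `l` that maps `[-1, 1]ⁿ` into the corner `w`. -/
noncomputable def cornerInv (l : ℝ) (w : Fin n → Bool) (x : EuclideanSpace ℝ (Fin n)) :
    EuclideanSpace ℝ (Fin n) :=
  l⁻¹ • (x - (1 - l) • signVector w)

/-- Transplantation of a function to all corners of the cube. -/
noncomputable def branchSum (l : ℝ) (F : EuclideanSpace ℝ (Fin n) → W) :
    EuclideanSpace ℝ (Fin n) → W :=
  fun x => ∑ w, F (cornerInv l w x)

/-- `F` vanishes outside the cube `[-R, R]ⁿ`. -/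
def VanishesOutsideCube (R : ℝ) (F : EuclideanSpace ℝ (Fin n) → W) : Prop :=
  ∀ x i, R < |x i| → F x = 0

theorem cornerInv_apply (w : Fin n → Bool) (x : EuclideanSpace ℝ (Fin n)) (i : Fin n) :
    cornerInv l w x i = l⁻¹ * (x i - (1 - l) * signVector w i) := by
  simp [cornerInv]

theorem abs_cornerInv_apply (hl : 0 < l) (w : Fin n → Bool) (x : EuclideanSpace ℝ (Fin n))
    (i : Fin n) : l * |cornerInv l w x i| = |x i - (1 - l) * signVector w i| := by
  rw [cornerInv_apply, abs_mul, abs_of_pos (inv_pos.2 hl), mul_inv_cancel_left₀ hl.ne']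

/-- The enlarged corner cubes have centres with coordinates `±(1 - l)` and half-side `l * R < 1 -
l`, so different ones are separated by a coordinate hyperplane. -/
theorem exists_lt_abs_cornerInv (hl : 0 < l) (hR : l * R < 1 - l) {w w' : Fin n → Bool}
    (hw : w ≠ w') {x : EuclideanSpace ℝ (Fin n)} (hx : ∀ i, |cornerInv l w x i| ≤ R) :
    ∃ i, R < |cornerInv l w' x i| := by
  obtain ⟨i, hi⟩ := Function.ne_iff.1 hw
  refine ⟨i, ?_⟩
  have h1 := mul_le_mul_of_nonneg_left (hx i) hl.le
  refine lt_of_mul_lt_mul_left ?_ hl.le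
  rw [abs_cornerInv_apply hl] at h1 ⊢
  rw [signVector_apply] at h1 ⊢
  rw [abs_le] at h1
  rw [lt_abs]
  cases h2 : w i <;> cases h3 : w' i <;> simp_all
  · right; linarith
  · left; linarith

theorem lt_abs_cornerInv (hl : 0 < l) (hl' : l < 1) (hR : 1 ≤ R) (w : Fin n → Bool)
    {x : EuclideanSpace ℝ (Fin n)} {i : Fin n} (hx : R < |x i|) : R < |cornerInv l w x i| := by
  refine lt_of_mul_lt_mul_left ?_ hl.le
  rw [abs_cornerInv_apply hl]
  have h1 : |(1 - l) * signVector w i| ≤ 1 - l := by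
    rw [abs_mul, abs_of_pos (by linarith), signVector_apply]
    split_ifs <;> simp
  have h2 := abs_sub_abs_le_abs_sub (x i) ((1 - l) * signVector w i)
  nlinarith

theorem vanishesOutsideCube_branchSum (hl : 0 < l) (hl' : l < 1) (hR : 1 ≤ R)
    (hF : VanishesOutsideCube R F) :
    VanishesOutsideCube R (branchSum l F) := fun _ _ hx =>
  Finset.sum_eq_zero fun w _ => hF _ _ (lt_abs_cornerInv hl hl' hR w hx)

theorem VanishesOutsideCube.exists_branch (hl : 0 < l) (hR : l * R < 1 - l)
    (hF : VanishesOutsideCube R F)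
    (x : EuclideanSpace ℝ (Fin n)) : ∃ w, ∀ w' ≠ w, F (cornerInv l w' x) = 0 := by
  by_cases h : ∃ w, ∀ i, |cornerInv l w x i| ≤ R
  · obtain ⟨w, hw⟩ := h
    refine ⟨w, fun w' hne => ?_⟩
    obtain ⟨i, hi⟩ := exists_lt_abs_cornerInv hl hR hne.symm hw
    exact hF _ i hi
  · push Not at h
    refine ⟨fun _ => true, fun w' _ => ?_⟩
    obtain ⟨i, hi⟩ := h w'
    exact hF _ i hi

theorem VanishesOutsideCube.exists_branchSum_eq (hl : 0 < l) (hR : l * R < 1 - l)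
    (hF : VanishesOutsideCube R F)
    (x : EuclideanSpace ℝ (Fin n)) : ∃ w, branchSum l F x = F (cornerInv l w x) := by
  obtain ⟨w, hw⟩ := hF.exists_branch hl hR x
  exact ⟨w, Finset.sum_eq_single w (fun w' _ h => hw w' h) (by simp)⟩

theorem VanishesOutsideCube.hasCompactSupport
    (hF : VanishesOutsideCube R F) : HasCompactSupport F := by
  refine HasCompactSupport.intro (isCompact_closedBall (0 : EuclideanSpace ℝ (Fin n))
    (√(∑ _i : Fin n, R ^ 2))) fun x hx => ?_
  by_contra hne
  refine hx ?_
  rw [mem_closedBall_zero_iff, EuclideanSpace.norm_eq]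
  refine Real.sqrt_le_sqrt (Finset.sum_le_sum fun i _ => ?_)
  exact pow_le_pow_left₀ (norm_nonneg _) (not_lt.1 fun h => hne (hF x i h)) 2

theorem contDiff_cornerInv (w : Fin n → Bool) : ContDiff ℝ 1 (cornerInv l w) :=
  (contDiff_id.sub contDiff_const).const_smul _

theorem lintegral_comp_cornerInv (hl : 0 < l) (w : Fin n → Bool)
    (g : EuclideanSpace ℝ (Fin n) → ℝ≥0∞) :
    ∫⁻ x, g (cornerInv l w x) = ENNReal.ofReal (l ^ n) * ∫⁻ x, g x := by
  have h1 : ∫⁻ x, g (cornerInv l w x) = ∫⁻ x, g (l⁻¹ • x) :=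
    lintegral_sub_right_eq_self (fun x => g (l⁻¹ • x)) _
  have he : MeasurableEmbedding fun x : EuclideanSpace ℝ (Fin n) => l⁻¹ • x :=
    (Homeomorph.smulOfNeZero l⁻¹ (inv_ne_zero hl.ne')).measurableEmbedding
  rw [h1, ← he.lintegral_map, Measure.map_addHaar_smul _ (inv_ne_zero hl.ne'),
    lintegral_smul_measure]
  simp [abs_of_pos (pow_pos hl n)]

/-- At each point at most one of the `2^n` copies is nonzero, and each copy scales the integral by
`l^n`. -/
theorem lintegral_enorm_branchSum_rpow_le (hl : 0 < l) (hR : l * R < 1 - l) (p : ℝ)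
    (hF : VanishesOutsideCube R F) (hc : Continuous F) :
    ∫⁻ x, ‖branchSum l F x‖ₑ ^ p ≤ ENNReal.ofReal ((2 * l) ^ n) * ∫⁻ x, ‖F x‖ₑ ^ p := by
  calc ∫⁻ x, ‖branchSum l F x‖ₑ ^ p
      ≤ ∫⁻ x, ∑ w, ‖F (cornerInv l w x)‖ₑ ^ p := lintegral_mono fun x => by
        obtain ⟨w, hw⟩ := hF.exists_branchSum_eq hl hR x
        simp only [hw]
        exact Finset.single_le_sum (f := fun w => ‖F (cornerInv l w x)‖ₑ ^ p)
          (fun _ _ => zero_le) (Finset.mem_univ w)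
    _ = ∑ w : Fin n → Bool, ∫⁻ x, ‖F (cornerInv l w x)‖ₑ ^ p :=
        lintegral_finsetSum _ fun w _ =>
          ((hc.comp (contDiff_cornerInv w).continuous).enorm.measurable.pow_const p)
    _ = _ := by
        simp only [fun w => lintegral_comp_cornerInv hl w fun x => ‖F x‖ₑ ^ p]
        rw [Finset.sum_const, nsmul_eq_mul, ← mul_assoc, mul_pow,
          ENNReal.ofReal_mul (by positivity)]
        simp [ENNReal.ofReal_pow]

theorem eLpNorm_branchSum_le (hl : 0 < l) (hR : l * R < 1 - l) {p : ℝ} (hp : 0 < p)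
    (hF : VanishesOutsideCube R F) (hc : Continuous F) :
    eLpNorm (branchSum l F) (ENNReal.ofReal p) volume ≤
      ENNReal.ofReal ((2 * l) ^ (n / p : ℝ)) * eLpNorm F (ENNReal.ofReal p) volume := by
  have hp0 : ENNReal.ofReal p ≠ 0 := by simpa using hp
  rw [eLpNorm_eq_lintegral_rpow_enorm_toReal hp0 ENNReal.ofReal_ne_top,
    eLpNorm_eq_lintegral_rpow_enorm_toReal hp0 ENNReal.ofReal_ne_top, ENNReal.toReal_ofReal hp.le]
  refine (ENNReal.rpow_le_rpow (lintegral_enorm_branchSum_rpow_le hl hR p hF hc)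
    (by positivity)).trans (le_of_eq ?_)
  rw [ENNReal.mul_rpow_of_nonneg _ _ (by positivity), ENNReal.ofReal_rpow_of_pos (by positivity),
    ← Real.rpow_natCast, ← Real.rpow_mul (by positivity), mul_one_div]

theorem vanishesOutsideCube_iterate_branchSum (hl : 0 < l) (hl' : l < 1) (hR : 1 ≤ R)
    (hF : VanishesOutsideCube R F) (k : ℕ) : VanishesOutsideCube R ((branchSum l)^[k] F) := by
  induction k with
  | zero => exact hF
  | succ k ih => rw [Function.iterate_succ_apply']; exact vanishesOutsideCube_branchSum hl hl' hR ih

theorem norm_iterate_branchSum_le (hl : 0 < l) (hl' : l < 1) (hR : 1 ≤ R) (hR' : l * R < 1 - l)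
    (hF : VanishesOutsideCube R F) {C : ℝ} (hC : ∀ x, ‖F x‖ ≤ C) (k : ℕ)
    (x : EuclideanSpace ℝ (Fin n)) : ‖(branchSum l)^[k] F x‖ ≤ C := by
  induction k generalizing x with
  | zero => exact hC x
  | succ k ih =>
    rw [Function.iterate_succ_apply']
    obtain ⟨w, hw⟩ :=
      (vanishesOutsideCube_iterate_branchSum hl hl' hR hF k).exists_branchSum_eq hl hR' x
    rw [hw]
    exact ih _

variable [NormedSpace ℝ W]

theorem vanishesOutsideCube_fderiv
    (hF : VanishesOutsideCube R F) : VanishesOutsideCube R (fderiv ℝ F) := fun x i hx => by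
  have hc : Continuous fun y : EuclideanSpace ℝ (Fin n) => |y i| := by fun_prop
  have : F =ᶠ[𝓝 x] fun _ => 0 := by
    filter_upwards [hc.continuousAt.eventually_const_lt hx] with y hy using hF y i hy
  rw [this.fderiv_eq, fderiv_fun_const]; rfl

theorem contDiff_branchSum (hF : ContDiff ℝ 1 F) :
    ContDiff ℝ 1 (branchSum l F) :=
  ContDiff.sum fun w _ => hF.comp (contDiff_cornerInv w)

theorem fderiv_branchSum (hF : Differentiable ℝ F) :
    fderiv ℝ (branchSum l F) = l⁻¹ • branchSum l (fderiv ℝ F) := by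
  ext1 x
  have hw : ∀ w ∈ Finset.univ, HasFDerivAt (fun x => F (cornerInv l w x))
      (l⁻¹ • fderiv ℝ F (cornerInv l w x)) x := fun w _ => by
    have h1 : HasFDerivAt (cornerInv l w)
        (l⁻¹ • ContinuousLinearMap.id ℝ (EuclideanSpace ℝ (Fin n))) x :=
      ((hasFDerivAt_id x).sub_const ((1 - l) • signVector w)).const_smul l⁻¹
    have h2 := (hF (cornerInv l w x)).hasFDerivAt.comp x h1
    rwa [ContinuousLinearMap.comp_smul, ContinuousLinearMap.comp_id] at h2
  rw [Pi.smul_apply, branchSum, Finset.smul_sum]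
  exact (HasFDerivAt.fun_sum hw).fderiv

theorem contDiff_iterate_branchSum (hF : ContDiff ℝ 1 F) (k : ℕ) :
    ContDiff ℝ 1 ((branchSum l)^[k] F) := by
  induction k with
  | zero => exact hF
  | succ k ih => rw [Function.iterate_succ_apply']; exact contDiff_branchSum ih

/-- Each transplantation costs `l⁻¹` by the chain rule and `(2 * l)^(n/p)` by the change of volume
over `2^n` disjoint copies. -/
theorem eLpNorm_fderiv_iterate_branchSum_le (hl : 0 < l) (hl' : l < 1) (hR : 1 ≤ R)
    (hR' : l * R < 1 - l) {p : ℝ} (hp : 0 < p) (hF : VanishesOutsideCube R F)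
    (hFc : ContDiff ℝ 1 F) (k : ℕ) :
    eLpNorm (fderiv ℝ ((branchSum l)^[k] F)) (ENNReal.ofReal p) volume ≤
      ENNReal.ofReal (l⁻¹ * (2 * l) ^ (n / p : ℝ)) ^ k *
        eLpNorm (fderiv ℝ F) (ENNReal.ofReal p) volume := by
  induction k with
  | zero => simp
  | succ k ih =>
    have hk := contDiff_iterate_branchSum (l := l) hFc k
    rw [Function.iterate_succ_apply', fderiv_branchSum (hk.differentiable one_ne_zero),
      eLpNorm_const_smul l⁻¹ (branchSum l (fderiv ℝ ((branchSum l)^[k] F))),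
      Real.enorm_eq_ofReal (inv_pos.2 hl).le]
    calc _ ≤ ENNReal.ofReal l⁻¹ * (ENNReal.ofReal ((2 * l) ^ (n / p : ℝ)) *
          eLpNorm (fderiv ℝ ((branchSum l)^[k] F)) (ENNReal.ofReal p) volume) := by
          gcongr
          exact eLpNorm_branchSum_le hl hR' hp
            (vanishesOutsideCube_fderiv (vanishesOutsideCube_iterate_branchSum hl hl' hR hF k))
            (hk.continuous_fderiv one_ne_zero)
      _ ≤ ENNReal.ofReal l⁻¹ * (ENNReal.ofReal ((2 * l) ^ (n / p : ℝ)) *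
          (ENNReal.ofReal (l⁻¹ * (2 * l) ^ (n / p : ℝ)) ^ k *
            eLpNorm (fderiv ℝ F) (ENNReal.ofReal p) volume)) := by gcongr
      _ = _ := by
          rw [pow_succ, ENNReal.ofReal_mul (inv_pos.2 hl).le]; ring

end branchSum

/-! ### Self-similar Cantor sets and digit-reading maps -/

section selfSimilar

variable {n : ℕ} {l R : ℝ}

/-- The scales of the self-similar Cantor set of contraction ratio `l` in `[-1, 1]ⁿ`. -/
noncomputable def selfSimilarScale (l : ℝ) (k : ℕ) : ℝ := (1 - l) * l ^ k

theorem hasSum_selfSimilarScale (hl : 0 < l) (hl' : l < 1) : HasSum (selfSimilarScale l) 1 := by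
  have := (hasSum_geometric_of_lt_one hl.le hl').mul_left (1 - l)
  rwa [mul_inv_cancel₀ (by linarith)] at this

theorem digitSum_selfSimilarScale (hl : 0 < l) (hl' : l < 1) (ξ : ℕ → Fin n → Bool) :
    digitSum (selfSimilarScale l) ξ = (1 - l) • signVector (ξ 0) +
      l • digitSum (selfSimilarScale l) fun k => ξ (k + 1) := by
  have hs := (hasSum_selfSimilarScale hl hl').summable
  rw [digitSum, (summable_digitSum hs ξ).tsum_eq_zero_add, digitSum,
    ← (summable_digitSum hs fun k => ξ (k + 1)).tsum_const_smul]
  congr 1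
  · simp [selfSimilarScale]
  · refine tsum_congr fun k => ?_
    rw [smul_smul, selfSimilarScale, selfSimilarScale]
    congr 1
    ring

theorem cornerInv_digitSum (hl : 0 < l) (hl' : l < 1) (ξ : ℕ → Fin n → Bool) :
    cornerInv l (ξ 0) (digitSum (selfSimilarScale l) ξ) =
      digitSum (selfSimilarScale l) fun k => ξ (k + 1) := by
  rw [cornerInv, digitSum_selfSimilarScale hl hl' ξ, add_sub_cancel_left, smul_smul,
    inv_mul_cancel₀ hl.ne', one_smul]

theorem abs_digitSum_selfSimilarScale_le (hl : 0 < l) (hl' : l < 1) (ξ : ℕ → Fin n → Bool)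
    (i : Fin n) : |digitSum (selfSimilarScale l) ξ i| ≤ 1 := by
  have hs := hasSum_selfSimilarScale hl hl'
  rw [digitSum_apply hs.summable, ← Real.norm_eq_abs]
  refine tsum_of_norm_bounded hs fun k => ?_
  have h0 : 0 ≤ selfSimilarScale l k := mul_nonneg (by linarith) (by positivity)
  rw [norm_mul, Real.norm_of_nonneg h0, signVector_apply]
  split_ifs <;> simp

theorem cornerInv_digitSum_of_ne (hl : 0 < l) (hl' : l < 1) (hR : 1 ≤ R) (hR' : l * R < 1 - l)
    (ξ : ℕ → Fin n → Bool) {w : Fin n → Bool} (hw : w ≠ ξ 0) :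
    ∃ i, R < |cornerInv l w (digitSum (selfSimilarScale l) ξ) i| := by
  refine exists_lt_abs_cornerInv hl hR' hw.symm fun i => ?_
  rw [cornerInv_digitSum hl hl']
  exact (abs_digitSum_selfSimilarScale_le hl hl' _ i).trans hR

theorem exists_cube_bump (hR : 1 < R) : ∃ f : EuclideanSpace ℝ (Fin n) → ℝ,
    ContDiff ℝ 1 f ∧ (∀ x, (∀ i, |x i| ≤ 1) → f x = 1) ∧ VanishesOutsideCube R f := by
  let θ : ContDiffBump (0 : ℝ) := ⟨1, R, one_pos, hR⟩
  refine ⟨fun x => ∏ i, θ (x i), contDiff_prod fun i _ => θ.contDiff.comp (by fun_prop),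
    fun x hx => Finset.prod_eq_one fun i _ => θ.one_of_mem_closedBall (by simpa [θ] using hx i),
    fun x i hx => Finset.prod_eq_zero (Finset.mem_univ i) (θ.zero_of_le_dist ?_)⟩
  simpa [θ] using hx.le

/-- On the Cantor set, `cornerInv` at the first digit shifts the sequence and all other corners
contribute zero; `k` transplantations therefore turn a reader of digit `0` into a reader of digit
`k`. -/
theorem iterate_branchSum_digitSum (hl : 0 < l) (hl' : l < 1) (hR : 1 ≤ R) (hR' : l * R < 1 - l)
    {F : EuclideanSpace ℝ (Fin n) → EuclideanSpace ℝ (Fin n)} (hF : VanishesOutsideCube R F)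
    (h0 : ∀ ξ, F (digitSum (selfSimilarScale l) ξ) = signVector (ξ 0)) (k : ℕ)
    (ξ : ℕ → Fin n → Bool) :
    (branchSum l)^[k] F (digitSum (selfSimilarScale l) ξ) = signVector (ξ k) := by
  induction k generalizing ξ with
  | zero => exact h0 ξ
  | succ k ih =>
    rw [Function.iterate_succ_apply', branchSum, Finset.sum_eq_single (ξ 0),
      cornerInv_digitSum hl hl', ih]
    · intro w _ hw
      obtain ⟨i, hi⟩ := cornerInv_digitSum_of_ne hl hl' hR hR' ξ hw
      exact vanishesOutsideCube_iterate_branchSum hl hl' hR hF k _ i hi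
    · simp

/-- Smooth maps that read off the digits of the points of a self-similar Cantor set, with control
of their gradients. -/
theorem exists_digit_maps (n : ℕ) (hl : 0 < l) (hl' : l < 1 / 2) {p : ℝ} (hp : 0 < p) :
    ∃ (U : ℕ → EuclideanSpace ℝ (Fin n) → EuclideanSpace ℝ (Fin n)) (C : ℝ),
      (∀ k, ContDiff ℝ 1 (U k)) ∧ (∀ k, HasCompactSupport (U k)) ∧ (∀ k x, ‖U k x‖ ≤ C) ∧
      (∀ k ξ, U k (digitSum (selfSimilarScale l) ξ) = signVector (ξ k)) ∧
      ∀ k, (eLpNorm (fderiv ℝ (U k)) (ENNReal.ofReal p) volume).toReal ≤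
        (l⁻¹ * (2 * l) ^ (n / p : ℝ)) ^ k * C := by
  -- Room for a cutoff that equals one on the unit cube while the corner copies stay disjoint; this
  -- needs `l < 1/2`.
  obtain ⟨R, hR, hR'⟩ : ∃ R, 1 < R ∧ R < (1 - l) / l :=
    exists_between (by rw [lt_div_iff₀ hl]; linarith)
  replace hR' : l * R < 1 - l := by rw [lt_div_iff₀ hl] at hR'; linarith
  have hl1 : l < 1 := by linarith
  obtain ⟨f, hfc, hf1, hf0⟩ := exists_cube_bump (n := n) hR
  let F : EuclideanSpace ℝ (Fin n) → EuclideanSpace ℝ (Fin n) :=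
    fun x => ∑ w, f (cornerInv l w x) • signVector w
  have hFc : ContDiff ℝ 1 F :=
    ContDiff.sum fun w _ => (hfc.comp (contDiff_cornerInv w)).smul contDiff_const
  have hF0 : VanishesOutsideCube R F := fun x i hx => Finset.sum_eq_zero fun w _ => by
    rw [hf0 _ i (lt_abs_cornerInv hl hl1 hR.le w hx), zero_smul]
  have hFd : ∀ ξ, F (digitSum (selfSimilarScale l) ξ) = signVector (ξ 0) := fun ξ => by
    simp only [F]
    rw [Finset.sum_eq_single (ξ 0), cornerInv_digitSum hl hl1,
      hf1 _ fun i => abs_digitSum_selfSimilarScale_le hl hl1 _ i, one_smul]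
    · intro w _ hw
      obtain ⟨i, hi⟩ := cornerInv_digitSum_of_ne hl hl1 hR.le hR' ξ hw
      rw [hf0 _ i hi, zero_smul]
    · simp
  obtain ⟨C, hC⟩ := hFc.continuous.bounded_above_of_compact_support hF0.hasCompactSupport
  have hmem : MemLp (fderiv ℝ F) (ENNReal.ofReal p) volume :=
    (hFc.continuous_fderiv one_ne_zero).memLp_of_hasCompactSupport (vanishesOutsideCube_fderiv hF0).hasCompactSupport
  refine ⟨fun k => (branchSum l)^[k] F,
    max C (eLpNorm (fderiv ℝ F) (ENNReal.ofReal p) volume).toReal,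
    fun k => contDiff_iterate_branchSum hFc k,
    fun k => (vanishesOutsideCube_iterate_branchSum hl hl1 hR.le hF0 k).hasCompactSupport,
    fun k x => (norm_iterate_branchSum_le hl hl1 hR.le hR' hF0 hC k x).trans (le_max_left _ _),
    fun k ξ => iterate_branchSum_digitSum hl hl1 hR.le hR' hF0 hFd k ξ, fun k => ?_⟩
  have h1 := eLpNorm_fderiv_iterate_branchSum_le hl hl1 hR.le hR' hp hF0 hFc k
  have hnn : 0 ≤ l⁻¹ * (2 * l) ^ (n / p : ℝ) := by positivity
  have h2 := ENNReal.toReal_mono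
    (ENNReal.mul_ne_top (ENNReal.pow_ne_top ENNReal.ofReal_ne_top) hmem.eLpNorm_ne_top) h1
  rw [ENNReal.toReal_mul, ENNReal.toReal_pow, ENNReal.toReal_ofReal hnn] at h2
  exact h2.trans (by gcongr; exact le_max_right _ _)

end selfSimilar

/-! ### Arithmetic of the exponents -/

section parameters

variable {n : ℕ} {p α σ : ℝ}

theorem two_rpow_neg_div_lt_half {s : ℝ} (hs : 0 < s) (hn : s < n) :
    (2 : ℝ) ^ (-n / s : ℝ) < 1 / 2 := by
  rw [one_div, ← Real.rpow_neg_one]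
  refine Real.rpow_lt_rpow_of_exponent_lt one_lt_two ?_
  rw [neg_div, neg_lt_neg_iff, one_lt_div hs]
  exact hn

theorem two_rpow_neg_div_pow_rpow {s : ℝ} (hs : 0 < s) (k : ℕ) :
    (((2 : ℝ) ^ (-n / s : ℝ)) ^ k) ^ s = ((2 : ℝ) ^ (n * k))⁻¹ := by
  rw [← Real.rpow_natCast, ← Real.rpow_mul two_pos.le, ← Real.rpow_mul two_pos.le,
    ← Real.rpow_natCast, ← Real.rpow_neg two_pos.le]
  congr 1
  push_cast
  field_simp

theorem imageExponent_pos (hp : (n : ℝ) < p) (hα : 0 < α)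
    (hσ : σ = p * α / (p + α - n)) : 0 < σ := by
  have : (0 : ℝ) ≤ n := n.cast_nonneg
  rw [hσ]
  exact div_pos (mul_pos (by linarith) hα) (by linarith)

theorem imageExponent_lt (hp : (n : ℝ) < p) (hα : 0 < α) (hαn : α < n)
    (hσ : σ = p * α / (p + α - n)) : σ < n := by
  rw [hσ, div_lt_iff₀ (by linarith)]
  nlinarith

/-- This is `n/σ = n/α + (n/p)(1 - n/α)`, the relation that determines `σ`. -/
theorem image_ratio_mul_gradient_ratio (hp : (n : ℝ) < p) (hα : 0 < α) (hαn : α < n)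
    (hσ : σ = p * α / (p + α - n)) :
    (2 : ℝ) ^ (-n / σ : ℝ) *
      (((2 : ℝ) ^ (-n / α : ℝ))⁻¹ * (2 * (2 : ℝ) ^ (-n / α : ℝ)) ^ (n / p : ℝ)) = 1 := by
  have h2 : (2 : ℝ) * (2 : ℝ) ^ (-n / α : ℝ) = 2 ^ (1 + -n / α : ℝ) := by
    rw [Real.rpow_add two_pos, Real.rpow_one]
  rw [h2, ← Real.rpow_mul two_pos.le, ← Real.rpow_neg two_pos.le, ← Real.rpow_add two_pos,
    ← Real.rpow_add two_pos, hσ]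
  have hp0 : p ≠ 0 := by linarith
  have hd : p + α - n ≠ 0 := by linarith
  convert Real.rpow_zero 2 using 2
  field_simp
  ring

end parameters

/-! ### Hausdorff measure of the source set -/

section measureBounds

variable {n : ℕ} {a : ℕ → ℝ} {μ : ℝ}

theorem inv_le_mkMetric_range_digitSum (hpos : ∀ k, 0 < a k) (hμ : 0 ≤ μ) (hμ' : μ < 1 / 2)
    (h : ∀ k, a (k + 1) ≤ μ * a k) (hn : n ≠ 0) (m : ℝ≥0∞ → ℝ≥0∞) {c : ℝ≥0} (hc : c ≠ 0) (K : ℕ)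
    (hm : ∀ k ≥ K, ∀ d < ⊤, ENNReal.ofReal (gapRatio μ * a (k + 1)) ≤ d →
      ((2 : ℝ≥0∞) ^ (n * (k + 1)))⁻¹ ≤ c * m d) :
    (c : ℝ≥0∞)⁻¹ ≤ Measure.mkMetric m
      (Set.range (digitSum a : _ → EuclideanSpace ℝ (Fin n))) := by
  have h1 := one_le_mkMetric_range_digitSum hpos hμ hμ' h hn ((c : ℝ≥0∞) • m) K hm
  rw [← Measure.toOuterMeasure_apply, Measure.mkMetric_toOuterMeasure,
    OuterMeasure.mkMetric_smul m ENNReal.coe_ne_top (ENNReal.coe_ne_zero.2 hc),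
    ← Measure.mkMetric_toOuterMeasure] at h1
  rw [ENNReal.inv_le_iff_le_mul (fun _ => by simpa using hc) (by simp)]
  exact h1

theorem norm_digitSum_selfSimilarScale_le {l : ℝ} (hl : 0 < l) (hl' : l < 1)
    (ξ : ℕ → Fin n → Bool) : ‖digitSum (selfSimilarScale l) ξ‖ ≤ √n := by
  have hs := (hasSum_selfSimilarScale hl hl').mul_right (√n)
  rw [one_mul] at hs
  refine tsum_of_norm_bounded hs fun k => ?_
  have h0 : 0 ≤ selfSimilarScale l k := mul_nonneg (by linarith) (by positivity)
  rw [norm_smul, norm_signVector, Real.norm_of_nonneg h0]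

theorem dist_digitSum_selfSimilarScale_le {l : ℝ} (hl : 0 < l) (hl' : l < 1) (k : ℕ)
    {ξ ξ' : ℕ → Fin n → Bool} (h : ∀ j < k, ξ j = ξ' j) :
    dist (digitSum (selfSimilarScale l) ξ) (digitSum (selfSimilarScale l) ξ') ≤
      2 * √n * l ^ k := by
  induction k generalizing ξ ξ' with
  | zero =>
    refine (dist_le_norm_add_norm _ _).trans ?_
    linarith [norm_digitSum_selfSimilarScale_le hl hl' ξ,
      norm_digitSum_selfSimilarScale_le hl hl' ξ']
  | succ k ih =>
    rw [digitSum_selfSimilarScale hl hl' ξ, digitSum_selfSimilarScale hl hl' ξ',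
      h 0 k.succ_pos, dist_add_left, dist_smul₀, Real.norm_of_nonneg hl.le, pow_succ]
    have := ih (ξ := fun k => ξ (k + 1)) (ξ' := fun k => ξ' (k + 1))
      fun j hj => h (j + 1) (by omega)
    nlinarith

/-- The `2^(n k)` cylinders of length `k` have images of diameter at most `2 * √n * l ^ k`. As `l ^
α = 2^(-n)`, their `α`-sums are bounded by `(2 * √n) ^ α` for every `k`. -/
theorem hausdorffMeasure_range_digitSum_lt_top {α : ℝ} (hα : 0 < α) (hαn : α < n) :
    μH[α] (Set.range (digitSum (selfSimilarScale ((2 : ℝ) ^ (-n / α : ℝ))) :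
      _ → EuclideanSpace ℝ (Fin n))) < ⊤ := by
  set l : ℝ := (2 : ℝ) ^ (-n / α : ℝ) with hl_def
  have hl : 0 < l := by positivity
  have hl' : l < 1 := (two_rpow_neg_div_lt_half hα hαn).trans (by norm_num)
  let t : (k : ℕ) → (Fin k → Fin n → Bool) → Set (EuclideanSpace ℝ (Fin n)) := fun k w =>
    digitSum (selfSimilarScale l) '' {ξ | ∀ j : Fin k, ξ j = w j}
  have hdiam : ∀ k w, Metric.ediam (t k w) ≤ ENNReal.ofReal (2 * √n * l ^ k) := fun k w => by
    rw [Metric.ediam_image_le_iff]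
    intro ξ hξ ξ' hξ'
    rw [edist_dist]
    refine ENNReal.ofReal_le_ofReal (dist_digitSum_selfSimilarScale_le hl hl' k fun j hj => ?_)
    exact (hξ ⟨j, hj⟩).trans (hξ' ⟨j, hj⟩).symm
  have hlim : Tendsto (fun k : ℕ => ENNReal.ofReal (2 * √n * l ^ k)) atTop (𝓝 0) := by
    have := (tendsto_pow_atTop_nhds_zero_of_lt_one hl.le hl').const_mul (2 * √n)
    rw [mul_zero] at this
    simpa using ENNReal.tendsto_ofReal this
  refine lt_of_le_of_lt (Measure.hausdorffMeasure_le_liminf_sum α _ _ hlim t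
    (.of_forall fun k w => hdiam k w) (.of_forall fun k => ?_)) ?_
  · rintro _ ⟨ξ, rfl⟩
    exact Set.mem_iUnion.2 ⟨fun j => ξ j, ξ, fun _ => rfl, rfl⟩
  refine lt_of_le_of_lt (liminf_le_of_le (a := ENNReal.ofReal ((2 * √n) ^ α)) (by isBoundedDefault)
    fun b hb => ?_) ENNReal.ofReal_lt_top
  obtain ⟨k, hk⟩ := hb.exists
  refine hk.trans ?_
  calc ∑ w, Metric.ediam (t k w) ^ α
      ≤ ∑ _w : Fin k → Fin n → Bool, ENNReal.ofReal (2 * √n * l ^ k) ^ α :=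
        Finset.sum_le_sum fun w _ => ENNReal.rpow_le_rpow (hdiam k w) hα.le
    _ = ENNReal.ofReal ((2 * √n) ^ α) := by
        rw [Finset.sum_const, nsmul_eq_mul, ENNReal.ofReal_rpow_of_nonneg (by positivity) hα.le,
          Real.mul_rpow (by positivity) (by positivity), two_rpow_neg_div_pow_rpow hα,
          ← ENNReal.ofReal_natCast, ← ENNReal.ofReal_mul (by positivity)]
        congr 1
        simp only [Finset.card_univ, Fintype.card_fun, Fintype.card_fin, Fintype.card_bool]
        push_cast
        rw [← pow_mul]
        field_simp

theorem hausdorffMeasure_range_digitSum_pos {α : ℝ} (hα : 0 < α) (hαn : α < n) :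
    0 < μH[α] (Set.range (digitSum (selfSimilarScale ((2 : ℝ) ^ (-n / α : ℝ))) :
      _ → EuclideanSpace ℝ (Fin n))) := by
  have hn : n ≠ 0 := by rintro rfl; simp at hαn; linarith
  set l : ℝ := (2 : ℝ) ^ (-n / α : ℝ) with hl_def
  have hl : 0 < l := by positivity
  have hl' : l < 1 / 2 := two_rpow_neg_div_lt_half hα hαn
  have hg := gapRatio_pos hl'
  have hg' : 0 < gapRatio l * (1 - l) := mul_pos hg (by linarith)
  -- This constant normalises the gauge so that its value at the gap of generation `k + 1` is
  -- exactly the cylinder mass.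
  have hc : Real.toNNReal ((gapRatio l * (1 - l)) ^ α)⁻¹ ≠ 0 := by
    simpa using Real.rpow_pos_of_pos hg' α
  refine lt_of_lt_of_le ?_ (inv_le_mkMetric_range_digitSum (a := selfSimilarScale l) (μ := l)
    (fun k => mul_pos (by linarith) (pow_pos hl k)) hl.le hl'
    (fun k => le_of_eq (by rw [selfSimilarScale, selfSimilarScale]; ring)) hn
    (fun r => r ^ α) hc 0 fun k _ d _ hd => ?_)
  · simp
  · calc ((2 : ℝ≥0∞) ^ (n * (k + 1)))⁻¹
        = ENNReal.ofReal (((gapRatio l * (1 - l)) ^ α)⁻¹ *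
            (gapRatio l * selfSimilarScale l (k + 1)) ^ α) := by
          rw [selfSimilarScale, ← mul_assoc, Real.mul_rpow hg'.le (by positivity),
            two_rpow_neg_div_pow_rpow hα,
            inv_mul_cancel_left₀ (Real.rpow_pos_of_pos hg' α).ne',
            ENNReal.ofReal_inv_of_pos (by positivity)]
          simp [ENNReal.ofReal_pow]
      _ = ENNReal.ofReal ((gapRatio l * (1 - l)) ^ α)⁻¹ *
            ENNReal.ofReal (gapRatio l * selfSimilarScale l (k + 1)) ^ α := by
          rw [ENNReal.ofReal_mul (by positivity), ENNReal.ofReal_rpow_of_nonneg _ hα.le]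
          exact mul_nonneg hg.le (mul_nonneg (by linarith) (by positivity))
      _ ≤ _ := by
          rw [ENNReal.ofReal]
          gcongr

end measureBounds

/-! ### Logarithmically corrected scales and the gauge measure -/

section logScale

/-- Geometric scales with a logarithmic correction. -/
noncomputable def logScale (μ b : ℝ) (k : ℕ) : ℝ := μ ^ k * (k + 1 : ℝ) ^ (-b)

variable {μ b : ℝ}

theorem logScale_pos (hμ : 0 < μ) (k : ℕ) : 0 < logScale μ b k := by
  unfold logScale; positivity

theorem logScale_succ_le (hμ : 0 < μ) (hb : 0 ≤ b) (k : ℕ) :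
    logScale μ b (k + 1) ≤ μ * logScale μ b k := by
  unfold logScale
  rw [pow_succ', mul_assoc]
  gcongr ?_ * (?_ * ?_)
  refine Real.rpow_le_rpow_of_nonpos (by positivity) ?_ (by linarith)
  push_cast; linarith

theorem logScale_le_pow (hμ : 0 < μ) (hb : 0 ≤ b) (k : ℕ) : logScale μ b k ≤ μ ^ k := by
  refine mul_le_of_le_one_right (by positivity) (Real.rpow_le_one_of_one_le_of_nonpos ?_ ?_)
  · linarith [k.cast_nonneg (α := ℝ)]
  · linarith

theorem summable_natCast_add_one_rpow_neg (hb : 1 < b) :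
    Summable fun k : ℕ => (k + 1 : ℝ) ^ (-b) := by
  have := (summable_nat_add_iff 1).2 (Real.summable_nat_rpow.2 (by linarith : -b < -1))
  simpa using this

theorem eventually_le_log_inv_logScale (hμ : 0 < μ) (hμ' : μ < 1) (hb : 0 ≤ b) {g : ℝ}
    (hg : 0 < g) : ∀ᶠ k : ℕ in atTop,
      Real.log μ⁻¹ / 2 * (k + 1) ≤ Real.log (1 / (g * logScale μ b k)) := by
  have hlog : 0 < Real.log μ⁻¹ := Real.log_pos ((one_lt_inv₀ hμ).2 hμ')
  -- Beyond this threshold, half of the linear growth `k * log μ⁻¹` absorbs `log g` and the shift to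
  -- `k + 1`.
  have hev := (tendsto_natCast_atTop_atTop (R := ℝ)).eventually_ge_atTop
    ((Real.log g + Real.log μ⁻¹ / 2) / (Real.log μ⁻¹ / 2))
  filter_upwards [hev] with k hk
  rw [div_le_iff₀ (by positivity)] at hk
  have h1 : Real.log (g * logScale μ b k) ≤ Real.log g + k * Real.log μ := by
    rw [Real.log_mul hg.ne' (logScale_pos hμ k).ne', ← Real.log_pow]
    gcongr
    · exact logScale_pos hμ k
    · exact logScale_le_pow hμ hb k
  rw [Real.log_inv] at hk ⊢
  rw [one_div, Real.log_inv]
  linarith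

/-- The power `σ` of the scale gives `2^(-n k) (k+1)^(-bσ)` and the logarithm gives at least a
multiple of `(k+1)^γ`; what survives is `(k+1)^(γ - bσ)`. -/
theorem tendsto_two_pow_mul_gauge_logScale {n : ℕ} {σ γ g : ℝ} (hσ : 0 < σ) (hσn : σ < n)
    (hb : 0 ≤ b) (hbγ : b * σ < γ) (hg : 0 < g) {φ : ℝ≥0 → ℝ≥0}
    (hφ : (fun r : ℝ≥0 => (r : ℝ) ^ σ * Real.log (1 / (r : ℝ)) ^ γ) =O[𝓝[>] 0]
      fun r : ℝ≥0 => (φ r : ℝ)) :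
    Tendsto (fun k : ℕ => (2 : ℝ) ^ (n * k) *
      φ (g * logScale ((2 : ℝ) ^ (-n / σ : ℝ)) b k).toNNReal) atTop atTop := by
  set μ : ℝ := (2 : ℝ) ^ (-n / σ : ℝ) with hμ_def
  have hμ : 0 < μ := by positivity
  have hμ' : μ < 1 := (two_rpow_neg_div_lt_half hσ hσn).trans (by norm_num)
  have hlog : 0 < Real.log μ⁻¹ := Real.log_pos ((one_lt_inv₀ hμ).2 hμ')
  have hγ : 0 < γ := lt_of_le_of_lt (by positivity) hbγ
  have hpos : ∀ k, 0 < g * logScale μ b k := fun k => mul_pos hg (logScale_pos hμ k)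
  obtain ⟨C, hC, hbound⟩ := hφ.exists_pos
  have hr0 : Tendsto (fun k => g * logScale μ b k) atTop (𝓝 0) := by
    refine squeeze_zero (fun k => (hpos k).le)
      (fun k => mul_le_mul_of_nonneg_left (logScale_le_pow hμ hb k) hg.le) ?_
    simpa using (tendsto_pow_atTop_nhds_zero_of_lt_one hμ.le hμ').const_mul g
  have hr : Tendsto (fun k => (g * logScale μ b k).toNNReal) atTop (𝓝[>] 0) := by
    refine tendsto_nhdsWithin_iff.2 ⟨?_, .of_forall fun k => ?_⟩
    · simpa using tendsto_real_toNNReal hr0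
    · simpa using hpos k
  have hmain : Tendsto (fun k : ℕ => C⁻¹ * g ^ σ * (Real.log μ⁻¹ / 2) ^ γ *
      (k + 1 : ℝ) ^ (γ - b * σ)) atTop atTop := by
    refine Tendsto.const_mul_atTop (by positivity) ((tendsto_rpow_atTop (by linarith)).comp ?_)
    exact tendsto_atTop_add_const_right _ _ tendsto_natCast_atTop_atTop
  refine tendsto_atTop_mono' _ ?_ hmain
  filter_upwards [hr.eventually hbound.bound, eventually_le_log_inv_logScale hμ hμ' hb hg]
    with k hk hkl
  have hL : 0 ≤ Real.log μ⁻¹ / 2 * (k + 1) := by positivity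
  rw [Real.coe_toNNReal _ (hpos k).le, Real.norm_of_nonneg
    (mul_nonneg (Real.rpow_nonneg (hpos k).le _) (Real.rpow_nonneg (hL.trans hkl) _)),
    Real.norm_of_nonneg (NNReal.coe_nonneg _)] at hk
  have hk1 : (0 : ℝ) < k + 1 := by positivity
  have hrσ : (g * logScale μ b k) ^ σ =
      g ^ σ * (((2 : ℝ) ^ (n * k))⁻¹ * (k + 1 : ℝ) ^ (-(b * σ))) := by
    rw [Real.mul_rpow hg.le (logScale_pos hμ k).le, logScale,
      Real.mul_rpow (by positivity) (by positivity), two_rpow_neg_div_pow_rpow hσ,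
      ← Real.rpow_mul hk1.le, neg_mul]
  calc C⁻¹ * g ^ σ * (Real.log μ⁻¹ / 2) ^ γ * (k + 1 : ℝ) ^ (γ - b * σ)
      = 2 ^ (n * k) * (C⁻¹ * ((g * logScale μ b k) ^ σ *
          (Real.log μ⁻¹ / 2 * (k + 1)) ^ γ)) := by
        rw [hrσ, Real.mul_rpow (by positivity) hk1.le, sub_eq_add_neg, Real.rpow_add hk1]
        field_simp
    _ ≤ 2 ^ (n * k) * (C⁻¹ * ((g * logScale μ b k) ^ σ *
          Real.log (1 / (g * logScale μ b k)) ^ γ)) := by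
        have := (hpos k).le
        gcongr
    _ ≤ 2 ^ (n * k) * (C⁻¹ * (C * φ (g * logScale μ b k).toNNReal)) := by gcongr
    _ = _ := by rw [inv_mul_cancel_left₀ hC.ne']

theorem gaugeHausdorffMeasure_range_digitSum_eq_top {n : ℕ} {σ γ : ℝ} (hσ : 0 < σ) (hσn : σ < n)
    (hb : 0 ≤ b) (hbγ : b * σ < γ) {φ : ℝ≥0 → ℝ≥0} (hφm : Monotone φ)
    (hφ : (fun r : ℝ≥0 => (r : ℝ) ^ σ * Real.log (1 / (r : ℝ)) ^ γ) =O[𝓝[>] 0]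
      fun r : ℝ≥0 => (φ r : ℝ)) :
    gaugeHausdorffMeasure φ (Set.range
      (digitSum (logScale ((2 : ℝ) ^ (-n / σ : ℝ)) b) : _ → EuclideanSpace ℝ (Fin n))) = ⊤ := by
  have hn : n ≠ 0 := by rintro rfl; simp at hσn; linarith
  have hμ' := two_rpow_neg_div_lt_half hσ hσn
  set μ : ℝ := (2 : ℝ) ^ (-n / σ : ℝ) with hμ_def
  have hμ : 0 < μ := by positivity
  refine ENNReal.eq_top_of_forall_nnreal_le fun r => ?_
  -- Even the gauge `φ / (r + 1)` eventually dominates the cylinder masses, so the measure is at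
  -- least `r + 1`.
  have hc : (r + 1)⁻¹ ≠ 0 := by positivity
  obtain ⟨K, hK⟩ := eventually_atTop.1 ((tendsto_two_pow_mul_gauge_logScale hσ hσn hb hbγ
    (gapRatio_pos hμ') hφ).eventually_ge_atTop ((r : ℝ) + 1))
  have h1 := inv_le_mkMetric_range_digitSum (n := n) (a := logScale μ b) (logScale_pos hμ) hμ.le hμ'
    (logScale_succ_le hμ hb) hn (fun d : ℝ≥0∞ => (φ d.toNNReal : ℝ≥0∞)) hc K fun k hk d hd hle => ?_
  · refine le_trans ?_ h1
    rw [← ENNReal.coe_inv hc, inv_inv]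
    exact_mod_cast le_self_add
  · lift d to ℝ≥0 using hd.ne
    have h2 := hK (k + 1) (by omega)
    have h3 : φ (gapRatio μ * logScale μ b (k + 1)).toNNReal ≤ φ d :=
      hφm (ENNReal.coe_le_coe.1 hle)
    have h4 : r + 1 ≤ 2 ^ (n * (k + 1)) * φ d := by
      refine le_trans ?_ (mul_le_mul_of_nonneg_left h3 zero_le)
      rw [← NNReal.coe_le_coe]
      push_cast
      exact h2
    have h5 : ((2 : ℝ≥0) ^ (n * (k + 1)))⁻¹ ≤ (r + 1)⁻¹ * φ d := by
      rw [inv_le_iff_one_le_mul₀ (by positivity), mul_assoc, ← div_eq_inv_mul,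
        one_le_div (by positivity), mul_comm]
      exact h4
    have h6 := ENNReal.coe_le_coe.2 h5
    rw [ENNReal.coe_inv (by positivity)] at h6
    simpa using h6

end logScale

/-! ### Construction of the map -/

theorem theorem5p1 (n : ℕ) (p α σ γ : ℝ) (hp : (n : ℝ) < p) (hα₀ : 0 < α) (hαn : α < (n : ℝ))
    (hσ : σ = p * α / (p + α - (n : ℝ))) (hγ : 1 + σ < γ)
    (φ : ℝ≥0 → ℝ≥0) (hφ : IsGauge φ)
    (hφ_log : (fun r : ℝ≥0 => (φ r : ℝ)) =Θ[𝓝[>] 0]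
      fun r : ℝ≥0 => (r : ℝ) ^ σ * Real.log (1 / (r : ℝ)) ^ γ) :
    ∃ (u : EuclideanSpace ℝ (Fin n) → EuclideanSpace ℝ (Fin n))
      (E : Set (EuclideanSpace ℝ (Fin n))),
      Continuous u ∧ MemHomogeneousSobolev (ENNReal.ofReal p) u ∧ IsCompact E ∧
        0 < μH[α] E ∧ μH[α] E < ⊤ ∧ gaugeHausdorffMeasure φ (u '' E) = ⊤ := by
  have hn : (1 : ℝ) ≤ n := by
    have : 0 < n := by exact_mod_cast hα₀.trans hαn
    exact_mod_cast this
  have hp1 : 1 < p := hn.trans_lt hp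
  have hσ0 : 0 < σ := imageExponent_pos hp hα₀ hσ
  have hσn : σ < n := imageExponent_lt hp hα₀ hαn hσ
  -- `b > 1` makes the gradient norms summable; `b * σ < γ` makes the image measure infinite.
  obtain ⟨b, hb, hbγ⟩ : ∃ b, 1 < b ∧ b < γ / σ :=
    exists_between (by rw [one_lt_div hσ0]; linarith)
  rw [lt_div_iff₀ hσ0] at hbγ
  have hl' := two_rpow_neg_div_lt_half hα₀ hαn
  have hμ' := two_rpow_neg_div_lt_half hσ0 hσn
  have hratio := image_ratio_mul_gradient_ratio hp hα₀ hαn hσ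
  have hEpos := hausdorffMeasure_range_digitSum_pos hα₀ hαn
  have hEfin := hausdorffMeasure_range_digitSum_lt_top hα₀ hαn
  have himage := gaugeHausdorffMeasure_range_digitSum_eq_top hσ0 hσn (by linarith) hbγ
    hφ.monotone hφ_log.isBigO_symm
  set l : ℝ := (2 : ℝ) ^ (-n / α : ℝ) with hl_def
  set μ : ℝ := (2 : ℝ) ^ (-n / σ : ℝ) with hμ_def
  have hl : 0 < l := by positivity
  have hμ : 0 < μ := by positivity
  set a := logScale μ b with ha_def
  have ha0 : ∀ k, 0 < a k := logScale_pos hμ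
  have ha : Summable a :=
    summable_of_ratio ha0 hμ.le (by linarith) (logScale_succ_le hμ (by linarith))
  obtain ⟨U, C, hU, hUc, hUC, hUd, hUG⟩ :=
    exists_digit_maps n hl hl' (p := p) (by linarith)
  have hbound : ∀ k x, ‖(a k • U k) x‖ ≤ a k * C := fun k x => by
    rw [Pi.smul_apply, norm_smul, Real.norm_of_nonneg (ha0 k).le]
    exact mul_le_mul_of_nonneg_left (hUC k x) (ha0 k).le
  have hsmooth : ∀ k, ContDiff ℝ 1 (a k • U k) := fun k => (hU k).const_smul (a k)
  have hgrad : Summable fun k =>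
      (eLpNorm (fderiv ℝ (a k • U k)) (ENNReal.ofReal p) volume).toReal := by
    refine Summable.of_nonneg_of_le (fun k => ENNReal.toReal_nonneg) (fun k => ?_)
      ((summable_natCast_add_one_rpow_neg hb).mul_right C)
    have h1 : fderiv ℝ (a k • U k) = a k • fderiv ℝ (U k) :=
      fderiv_const_smul_field (a k)
    rw [h1, eLpNorm_const_smul (a k) (fderiv ℝ (U k)), ENNReal.toReal_mul, toReal_enorm,
      Real.norm_of_nonneg (ha0 k).le]
    calc _ ≤ a k * ((l⁻¹ * (2 * l) ^ (n / p : ℝ)) ^ k * C) :=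
          mul_le_mul_of_nonneg_left (hUG k) (ha0 k).le
      _ = (μ * (l⁻¹ * (2 * l) ^ (n / p : ℝ))) ^ k * ((k + 1 : ℝ) ^ (-b) * C) := by
          rw [ha_def, logScale, mul_pow]; ring
      _ = _ := by rw [hratio, one_pow, one_mul]
  have hpq := (Real.HolderConjugate.conjExponent hp1).ennrealOfReal
  refine ⟨fun x => ∑' k, (a k • U k) x, Set.range (digitSum (selfSimilarScale l)),
    continuous_tsum (fun k => (hsmooth k).continuous) (ha.mul_right C) hbound,
    memHomogeneousSobolev_tsum (hpq := hpq) _ _ hsmooth (fun k => (hUc k).smul_left)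
      (ha.mul_right C) hbound hgrad,
    isCompact_range (continuous_digitSum (hasSum_selfSimilarScale hl (by linarith)).summable),
    hEpos, hEfin, ?_⟩
  -- On `E` each `U k` returns the `k`-th sign vector, so `u '' E` is the Cantor set with scales
  -- `a`.
  rw [← Set.range_comp, ← himage]
  congr 2
  ext1 ξ
  simp only [Function.comp_apply, Pi.smul_apply, hUd]
  rfl
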